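/- Let $m\ge 1$. Consider $m+1$ parties: Alice, who holds $\mathbb C^{m+2}$ with orthonormal basis $|p\rangle,|q\rangle,|1\rangle,\dots,|m\rangle$, and Bob-$1,\dots,$ Bob-$m$, where Bob-$j$ holds $\mathbb C^{3}$ with orthonormal basis $|p\rangle,|q\rangle,|j\rangle$. Put $|\epsilon_\pm\rangle=\frac1{\sqrt2}(|p\rangle\pm|q\rangle)$ and $|\gamma^i_\pm\rangle=\frac1{\sqrt2}(|q\rangle\pm|i\rangle)$, and let $\mathbb G_{m+1}\subset\mathbb C^{m+2}\otimes(\mathbb C^3)^{\otimes m}$ consist of the $6m+2$ states $$|\zeta^0_\pm\rangle=|\epsilon_\pm\rangle_A\bigotimes_{j=1}^m|j\rangle_{B_j},\qquad |\zeta^{i,1}_\pm\rangle=|i\rangle_A\,|\gamma^i_\pm\rangle_{B_i}\bigotimes_{j\ne i}|j\rangle_{B_j},$$ $$|\zeta^{i,2}_\pm\rangle=|\gamma^i_\pm\rangle_A\,|p\rangle_{B_i}\bigotimes_{j\ne i}|j\rangle_{B_j},\qquad |\zeta^{i,3}_\pm\rangle=|p\rangle_A\,|\epsilon_\pm\rangle_{B_i}\bigotimes_{j\ne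 i}|j\rangle_{B_j}\qquad(1\le i\le m).$$ Then $\mathbb G_{m+1}$ is a genuinely nonlocal set of product states (GNPS): its members are orthonormal fully product states, and whenever the $m+1$ parties are divided into groups, not all of them in one group, with the members of each group coming together, no protocol of local operations (each group acting on its joint system) and classical communication between the groups, with finitely many or unboundedly many rounds, identifies every state of $\mathbb G_{m+1}$ with probability one. In particular, perfect LOCC discrimination of $\mathbb G_{m+1}$ is impossible even if any $m$ of the $m+1$ parties come together. -/

import Mathlib

open scoped Matrix

noncomputable section

/-!
Composite systems: the Hilbert space of parties `c : κ` with local orthonormal bases indexed by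
`X c` is `EuclideanSpace ℂ (∀ c, X c)`, i.e. the tensor product `⨂ c, ℂ^(X c)` in coordinates.
-/

/-- The tensor product operator `⨂ c, A c` applied to a (not necessarily normalized) vector. -/
def applyLocal {κ : Type} [Fintype κ] [DecidableEq κ] {X Y : κ → Type} [∀ c, Fintype (X c)]
    (A : ∀ c, Matrix (Y c) (X c) ℂ) (v : (∀ c, X c) → ℂ) : (∀ c, Y c) → ℂ :=
  fun y => ∑ x, (∏ c, A c (y c) (x c)) * v x

/-- The fully product vector `⨂ j, φ j`. -/
def productState {ι : Type} [Fintype ι] {X : ι → Type}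
    (φ : ∀ j, EuclideanSpace ℂ (X j)) : EuclideanSpace ℂ (∀ j, X j) :=
  WithLp.toLp 2 fun x => ∏ j, φ j (x j)

/-- An LOCC protocol of the parties `κ`, with local systems `ℂ^(X c)`, whose task is to announce
an element of `G`. The number of rounds need not be bounded.

A node is the classical information (the transcript) that is known to all the parties. At first
every party may enlarge its system by an isometry, such as adding a local ancilla. At a node
without verdict one party, the actor, performs a measurement on its own system with finitely many
outcomes, given by Kraus operators, and broadcasts the outcome; every other party may then apply to
its own system an isometry that depends on the outcome. At a node with a verdict the protocol
stops and the verdict is announced (what the other fields say at such a node is irrelevant).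
All local dimensions may change from node to node. -/
structure LOCCProtocol (κ : Type) (X : κ → Type) [∀ c, Fintype (X c)] [∀ c, DecidableEq (X c)]
    (G : Type) where
  Node : Type
  root : Node
  dim : Node → κ → ℕ
  init : ∀ c, Matrix (Fin (dim root c)) (X c) ℂ
  init_isometry : ∀ c, (init c)ᴴ * init c = 1
  verdict : Node → Option G
  actor : Node → κ
  outcomes : Node → ℕ
  next : ∀ s, Fin (outcomes s) → Node
  kraus : ∀ s (k : Fin (outcomes s)) (c : κ), Matrix (Fin (dim (next s k) c)) (Fin (dim s c)) ℂ
  kraus_complete : ∀ s, ∑ k, (kraus s k (actor s))ᴴ * kraus s k (actor s) = 1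
  kraus_isometry : ∀ s k c, c ≠ actor s → (kraus s k c)ᴴ * kraus s k c = 1

/-- The probability that, from node `s` with the unnormalized state vector `v`, the protocol
stops within `n` further rounds and announces `g`. -/
def LOCCProtocol.prob {κ : Type} [Fintype κ] [DecidableEq κ] {X : κ → Type}
    [∀ c, Fintype (X c)] [∀ c, DecidableEq (X c)] {G : Type} [DecidableEq G]
    (P : LOCCProtocol κ X G) (g : G) :
    ℕ → (s : P.Node) → ((∀ c, Fin (P.dim s c)) → ℂ) → ℝ
  | 0, s, v => if P.verdict s = some g then ∑ x, ‖v x‖ ^ 2 else 0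
  | n + 1, s, v =>
    match P.verdict s with
    | some g' => if g' = g then ∑ x, ‖v x‖ ^ 2 else 0
    | none => ∑ k, P.prob g n (P.next s k) (applyLocal (P.kraus s k) v)

/-- A family of unit vectors is perfectly discriminated by LOCC if some protocol, on the input of
any member of the family, announces that member with probability one. (The protocol may use
unboundedly many rounds; for one that always stops by round `N` the sequence is constant from
`N` on.) -/
def LOCCDiscriminable {κ : Type} [Fintype κ] [DecidableEq κ] {X : κ → Type}
    [∀ c, Fintype (X c)] [∀ c, DecidableEq (X c)] {G : Type} [DecidableEq G]
    (ψ : G → EuclideanSpace ℂ (∀ c, X c)) : Prop :=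
  ∃ P : LOCCProtocol κ X G, ∀ g,
    Filter.Tendsto (fun n => P.prob g n P.root (applyLocal P.init fun x => ψ g x))
      Filter.atTop (nhds 1)

/-- The parties `j : ι` come together in groups, `part j` being the group of `j`. The system of
group `c` is the tensor product of the systems of its members. This is the same vector, viewed
as a state of the groups. -/
def regroup {ι : Type} {X : ι → Type} {κ : Type} (part : ι → κ)
    (ψ : EuclideanSpace ℂ (∀ j, X j)) :
    EuclideanSpace ℂ (∀ c : κ, ∀ j : {j : ι // part j = c}, X j) :=
  WithLp.toLp 2 fun y => ψ fun j => y (part j) ⟨j, rfl⟩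

/-- Genuinely nonlocal set of product states in `⨂ j, ℂ^(d j)`: orthonormal fully product states
that cannot be perfectly discriminated by LOCC, however the parties come together in groups, as
long as they are not all in one group. -/
def IsGNPS {ι : Type} [Fintype ι] [DecidableEq ι] {d : ι → ℕ} {G : Type} [DecidableEq G]
    (ψ : G → EuclideanSpace ℂ (∀ j, Fin (d j))) : Prop :=
  (∀ g, ∃ φ : ∀ j, EuclideanSpace ℂ (Fin (d j)),
      (∀ j, ‖φ j‖ = 1) ∧ ψ g = productState φ) ∧
  Orthonormal ℂ ψ ∧
  ∀ (k : ℕ) (part : ι → Fin k), (∃ a b, part a ≠ part b) →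
    ¬ LOCCDiscriminable fun g => regroup part (ψ g)

/-- Alice (`none`) and the `m` Bobs (`some i`). -/
abbrev Party (m : ℕ) : Type := Option (Fin m)

/-- Alice holds `ℂ^(m+2)`, with basis `p, q, 1, …, m` numbered `0, 1, 2, …, m + 1`; the `i`-th Bob
holds `ℂ^3`, with basis `p, q, i` numbered `0, 1, 2`. -/
abbrev partyDim (m : ℕ) : Party m → ℕ
  | none => m + 2
  | some _ => 3

/-- The names of the states `ζ^0_±`, `ζ^{i,1}_±`, `ζ^{i,2}_±`, `ζ^{i,3}_±`, with sign `σ = ±1`. -/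
inductive StateLabel (m : ℕ) : Type
  | zeta0 (σ : ℤˣ)
  | zeta1 (i : Fin m) (σ : ℤˣ)
  | zeta2 (i : Fin m) (σ : ℤˣ)
  | zeta3 (i : Fin m) (σ : ℤˣ)
  deriving DecidableEq

/-- The basis vector `|a⟩` of `ℂ^n`. -/
def ket {n : ℕ} (a : Fin n) : EuclideanSpace ℂ (Fin n) := EuclideanSpace.single a 1

/-- `(|a⟩ + σ |b⟩) / √2`. -/
def superpose {n : ℕ} (σ : ℤˣ) (a b : Fin n) : EuclideanSpace ℂ (Fin n) :=
  ((1 / Real.sqrt 2 : ℝ) : ℂ) • (ket a + (((σ : ℤ) : ℂ)) • ket b)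

/-- Alice's tensor factor of each state. -/
def aliceFactor (m : ℕ) : StateLabel m → EuclideanSpace ℂ (Fin (m + 2))
  | .zeta0 σ => superpose σ 0 1
  | .zeta1 i _ => ket i.succ.succ
  | .zeta2 i σ => superpose σ 1 i.succ.succ
  | .zeta3 _ _ => ket 0

/-- The tensor factor of the `j`-th Bob in each state. -/
def bobFactor (m : ℕ) (j : Fin m) : StateLabel m → EuclideanSpace ℂ (Fin 3)
  | .zeta0 _ => ket 2
  | .zeta1 i σ => if j = i then superpose σ 1 2 else ket 2
  | .zeta2 i _ => if j = i then ket 0 else ket 2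
  | .zeta3 i σ => if j = i then superpose σ 0 1 else ket 2

/-- The states of `𝔾_{m+1}` in `ℂ^(m+2) ⊗ (ℂ^3)^{⊗ m}`. -/
def gState (m : ℕ) (g : StateLabel m) : EuclideanSpace ℂ (∀ j, Fin (partyDim m j)) :=
  productState fun
    | none => aliceFactor m g
    | some j => bobFactor m j g

/-- The grouping in which all the parties other than `j` come together. -/
def allBut {ι : Type} [DecidableEq ι] (j : ι) : ι → Fin 2 := fun i => if i = j then 0 else 1

end

/-! If the parties are not all in one group, some Bob-$i$ is outside Alice's group. The eight states
$\zeta^0_\pm$, $\zeta^{i,1}_\pm$, $\zeta^{i,2}_\pm$, $\zeta^{i,3}_\pm$ are the domino states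
(without the central one) on the span of $p,q,i$ at Alice and at Bob-$i$, while every other party
holds a fixed basis vector (`regroup_gState_dominoLabel`). So it suffices that two groups cannot
identify embedded domino states.

Perfect identification passes to every branch (`Identifies.next`) and forces orthogonality there,
even with unboundedly many rounds (`Identifies.dotProduct_eq_zero`). An operator on one side that
keeps the domino states orthogonal is scalar (`exists_eq_smul_one_of_dominoAlice`,
`exists_eq_smul_one_of_dominoBob`). By induction, on every branch of nonzero probability the
accumulated Kraus operators of both groups act on the domino spaces as multiples of isometries.

Hence every outcome, and so every verdict, is equally likely for all eight states
(`prob_dominoVec_eq`). A single vector would then be identified under two labels, hence be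
orthogonal to itself, though it is nonzero. -/

noncomputable section

/-! ### Product vectors and local operators. -/

/-- The tensor product of the vectors `w c`, in coordinates. -/
def prodVec {κ : Type} [Fintype κ] {X : κ → Type} (w : ∀ c, X c → ℂ) : (∀ c, X c) → ℂ :=
  fun x => ∏ c, w c (x c)

/-- The squared Euclidean norm. -/
def sqNorm {α : Type} [Fintype α] (v : α → ℂ) : ℝ := ∑ x, ‖v x‖ ^ 2

theorem sqNorm_nonneg {α : Type} [Fintype α] (v : α → ℂ) : 0 ≤ sqNorm v :=
  Finset.sum_nonneg fun _ _ => by positivity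

theorem ofReal_sqNorm {α : Type} [Fintype α] (v : α → ℂ) :
    ((sqNorm v : ℝ) : ℂ) = star v ⬝ᵥ v := by
  simp only [sqNorm, dotProduct, Complex.ofReal_sum, Pi.star_apply]
  refine Finset.sum_congr rfl fun x _ => ?_
  rw [RCLike.star_def, RCLike.conj_mul]
  simp

theorem sqNorm_eq_of_dotProduct_eq {α β : Type} [Fintype α] [Fintype β] {v : α → ℂ} {w : β → ℂ}
    (h : star v ⬝ᵥ v = star w ⬝ᵥ w) : sqNorm v = sqNorm w := by
  rw [← ofReal_sqNorm, ← ofReal_sqNorm] at h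
  exact_mod_cast h

theorem eq_zero_of_sqNorm_eq_zero {α : Type} [Fintype α] {v : α → ℂ} (h : sqNorm v = 0) :
    v = 0 := by
  funext x
  have := (Finset.sum_eq_zero_iff_of_nonneg (fun x _ => by positivity)).1 h x (Finset.mem_univ x)
  simpa using this

theorem norm_star_dotProduct_le {α : Type} [Fintype α] (u v : α → ℂ) :
    ‖star u ⬝ᵥ v‖ ≤ √(sqNorm u) * √(sqNorm v) := by
  have h := norm_inner_le_norm (𝕜 := ℂ) (WithLp.toLp 2 u) (WithLp.toLp 2 v)
  rw [EuclideanSpace.norm_eq, EuclideanSpace.norm_eq, EuclideanSpace.inner_toLp_toLp,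
    dotProduct_comm] at h
  exact h

theorem star_prodVec_dotProduct {κ : Type} [Fintype κ] [DecidableEq κ] {X : κ → Type}
    [∀ c, Fintype (X c)] (u w : ∀ c, X c → ℂ) :
    star (prodVec u) ⬝ᵥ prodVec w = ∏ c, star (u c) ⬝ᵥ w c := by
  simp only [prodVec, dotProduct, Pi.star_apply, star_prod, ← Finset.prod_mul_distrib]
  rw [Finset.prod_univ_sum, Fintype.piFinset_univ]

theorem applyLocal_prodVec {κ : Type} [Fintype κ] [DecidableEq κ] {X Y : κ → Type}
    [∀ c, Fintype (X c)] (A : ∀ c, Matrix (Y c) (X c) ℂ) (w : ∀ c, X c → ℂ) :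
    applyLocal A (prodVec w) = prodVec fun c => A c *ᵥ w c := by
  funext y
  simp only [applyLocal, prodVec, Matrix.mulVec, dotProduct, ← Finset.prod_mul_distrib]
  rw [Finset.prod_univ_sum, Fintype.piFinset_univ]

/-- Local operators affect inner products only through their Gram matrices, so isometries drop out
and completeness of a measurement can be applied. -/
theorem star_applyLocal_dotProduct {κ : Type} [Fintype κ] [DecidableEq κ] {X Y : κ → Type}
    [∀ c, Fintype (X c)] [∀ c, Fintype (Y c)] (A : ∀ c, Matrix (Y c) (X c) ℂ)
    (u v : (∀ c, X c) → ℂ) :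
    star (applyLocal A u) ⬝ᵥ applyLocal A v =
      ∑ x, ∑ x', star (u x) * v x' * ∏ c, ((A c)ᴴ * A c) (x c) (x' c) := by
  have h (x x' : ∀ c, X c) : ∏ c, ((A c)ᴴ * A c) (x c) (x' c) =
      ∑ y : ∀ c, Y c, (∏ c, star (A c (y c) (x c))) * ∏ c, A c (y c) (x' c) := by
    simp only [Matrix.mul_apply, Matrix.conjTranspose_apply, ← Finset.prod_mul_distrib]
    rw [Finset.prod_univ_sum, Fintype.piFinset_univ]
  simp only [h, Finset.mul_sum]
  simp only [applyLocal, dotProduct, Pi.star_apply, star_sum, star_mul', star_prod,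
    Finset.sum_mul_sum]
  rw [Finset.sum_comm]
  refine Finset.sum_congr rfl fun x _ => ?_
  rw [Finset.sum_comm]
  refine Finset.sum_congr rfl fun x' _ => Finset.sum_congr rfl fun y _ => ?_
  ring

/-- A local measurement of one party, the others applying isometries, preserves the total inner
product. -/
theorem sum_star_applyLocal_dotProduct {κ : Type} [Fintype κ] [DecidableEq κ] {X : κ → Type}
    [∀ c, Fintype (X c)] [∀ c, DecidableEq (X c)] {N : Type} [Fintype N]
    {Y : N → κ → Type} [∀ k c, Fintype (Y k c)]
    (A : ∀ k c, Matrix (Y k c) (X c) ℂ) (a : κ) (ha : ∑ k, (A k a)ᴴ * A k a = 1)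
    (hiso : ∀ k c, c ≠ a → (A k c)ᴴ * A k c = 1) (u v : (∀ c, X c) → ℂ) :
    ∑ k, star (applyLocal (A k) u) ⬝ᵥ applyLocal (A k) v = star u ⬝ᵥ v := by
  have h (x x' : ∀ c, X c) : ∑ k, ∏ c, ((A k c)ᴴ * A k c) (x c) (x' c) =
      if x = x' then 1 else 0 := by
    -- Away from the actor all Gram matrices are the identity, so only the actor's factor depends on
    -- the outcome, and completeness sums it.
    have h1 (k : N) : ∏ c, ((A k c)ᴴ * A k c) (x c) (x' c) =
        ((A k a)ᴴ * A k a) (x a) (x' a) *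
          ∏ c ∈ Finset.univ.erase a, (1 : Matrix (X c) (X c) ℂ) (x c) (x' c) := by
      rw [← Finset.mul_prod_erase _ _ (Finset.mem_univ a)]
      congr 1
      refine Finset.prod_congr rfl fun c hc => ?_
      rw [hiso k c (Finset.ne_of_mem_erase hc)]
    simp only [h1, ← Finset.sum_mul]
    rw [← Matrix.sum_apply, ha,
      Finset.mul_prod_erase _ (fun c => (1 : Matrix (X c) (X c) ℂ) (x c) (x' c))
        (Finset.mem_univ a)]
    simp only [Matrix.one_apply, Finset.prod_ite_zero, Finset.prod_const_one, funext_iff,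
      Finset.mem_univ, true_imp_iff]
  simp only [star_applyLocal_dotProduct]
  rw [Finset.sum_comm]
  simp only [dotProduct, Pi.star_apply]
  refine Finset.sum_congr rfl fun x _ => ?_
  rw [Finset.sum_comm]
  simp only [← Finset.mul_sum, h]
  simp

/-! ### Perfect identification and orthogonality. -/

namespace LOCCProtocol

variable {κ : Type} [Fintype κ] [DecidableEq κ] {X : κ → Type} [∀ c, Fintype (X c)]
  [∀ c, DecidableEq (X c)] {G : Type} (P : LOCCProtocol κ X G)

theorem sum_star_kraus_dotProduct (s : P.Node) (u v : (∀ c, Fin (P.dim s c)) → ℂ) :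
    ∑ k, star (applyLocal (P.kraus s k) u) ⬝ᵥ applyLocal (P.kraus s k) v = star u ⬝ᵥ v :=
  sum_star_applyLocal_dotProduct (P.kraus s) (P.actor s) (P.kraus_complete s)
    (P.kraus_isometry s) u v

theorem sum_sqNorm_kraus (s : P.Node) (u : (∀ c, Fin (P.dim s c)) → ℂ) :
    ∑ k, sqNorm (applyLocal (P.kraus s k) u) = sqNorm u := by
  have h := P.sum_star_kraus_dotProduct s u u
  simp only [← ofReal_sqNorm] at h
  exact_mod_cast h

variable [DecidableEq G]

theorem prob_zero_of_none {g : G} {s : P.Node} (hs : P.verdict s = none)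
    (v : (∀ c, Fin (P.dim s c)) → ℂ) : P.prob g 0 s v = 0 := by
  simp [prob, hs]

theorem prob_succ_of_none {g : G} {s : P.Node} (hs : P.verdict s = none) (n : ℕ)
    (v : (∀ c, Fin (P.dim s c)) → ℂ) :
    P.prob g (n + 1) s v =
      ∑ k, P.prob g n (P.next s k) (applyLocal (P.kraus s k) v) := by
  rw [prob, hs]

theorem prob_of_some {g g' : G} {s : P.Node} (hs : P.verdict s = some g') (n : ℕ)
    (v : (∀ c, Fin (P.dim s c)) → ℂ) :
    P.prob g n s v = if g' = g then sqNorm v else 0 := by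
  cases n with
  | zero => simp [prob, hs, sqNorm]
  | succ n => rw [prob, hs]; rfl

theorem prob_le (g : G) (n : ℕ) (s : P.Node) (v : (∀ c, Fin (P.dim s c)) → ℂ) :
    P.prob g n s v ≤ sqNorm v := by
  induction n generalizing s with
  | zero =>
    rcases hs : P.verdict s with _ | g'
    · rw [P.prob_zero_of_none hs]; exact sqNorm_nonneg v
    · rw [P.prob_of_some hs]; split_ifs; exacts [le_rfl, sqNorm_nonneg v]
  | succ n ih =>
    rcases hs : P.verdict s with _ | g'
    · rw [P.prob_succ_of_none hs, ← P.sum_sqNorm_kraus s v]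
      exact Finset.sum_le_sum fun k _ => ih _ _
    · rw [P.prob_of_some hs]; split_ifs; exacts [le_rfl, sqNorm_nonneg v]

/-- The overlap of two vectors is bounded by the probabilities of failing to identify them. -/
theorem norm_dotProduct_le {g h : G} (hgh : g ≠ h) (n : ℕ) (s : P.Node)
    (u v : (∀ c, Fin (P.dim s c)) → ℂ) :
    ‖star u ⬝ᵥ v‖ ≤ √(sqNorm u - P.prob g n s u) * √(sqNorm v) +
      √(sqNorm u) * √(sqNorm v - P.prob h n s v) := by
  -- If one success probability vanishes, one summand is already the Cauchy–Schwarz bound. This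
  -- covers exhausted rounds and all verdicts, since no verdict is both `g` and `h`.
  have key (s : P.Node) (u v : (∀ c, Fin (P.dim s c)) → ℂ) (n : ℕ)
      (h0 : P.prob g n s u = 0 ∨ P.prob h n s v = 0) :
      ‖star u ⬝ᵥ v‖ ≤ √(sqNorm u - P.prob g n s u) * √(sqNorm v) +
        √(sqNorm u) * √(sqNorm v - P.prob h n s v) := by
    have := norm_star_dotProduct_le u v
    rcases h0 with h0 | h0
    · rw [h0, sub_zero]; exact this.trans (le_add_of_nonneg_right (by positivity))
    · rw [h0, sub_zero]; exact this.trans (le_add_of_nonneg_left (by positivity))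
  have hsome (s : P.Node) (u v : (∀ c, Fin (P.dim s c)) → ℂ) (n : ℕ) (g' : G)
      (hs : P.verdict s = some g') : P.prob g n s u = 0 ∨ P.prob h n s v = 0 := by
    rw [P.prob_of_some hs, P.prob_of_some hs]
    by_cases h1 : g' = g
    · right; rw [if_neg (h1 ▸ hgh)]
    · left; rw [if_neg h1]
  induction n generalizing s with
  | zero =>
    rcases hs : P.verdict s with _ | g'
    · exact key s u v 0 (Or.inl (P.prob_zero_of_none hs u))
    · exact key s u v 0 (hsome s u v 0 g' hs)
  | succ n ih =>
    rcases hs : P.verdict s with _ | g'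
    swap
    · exact key s u v _ (hsome s u v _ g' hs)
    rw [P.prob_succ_of_none hs, P.prob_succ_of_none hs, ← P.sum_star_kraus_dotProduct s u v,
      ← P.sum_sqNorm_kraus s u, ← P.sum_sqNorm_kraus s v, ← Finset.sum_sub_distrib,
      ← Finset.sum_sub_distrib]
    refine (norm_sum_le _ _).trans ((Finset.sum_le_sum fun k _ => ih _ _ _).trans ?_)
    rw [Finset.sum_add_distrib]
    -- Cauchy–Schwarz over the branches: the failure probabilities and the squared norms each add up
    -- to those of the parent.
    exact add_le_add
      (Real.sum_sqrt_mul_sqrt_le _ (fun k => sub_nonneg.2 (P.prob_le _ _ _ _))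
        fun k => sqNorm_nonneg _)
      (Real.sum_sqrt_mul_sqrt_le _ (fun k => sqNorm_nonneg _)
        fun k => sub_nonneg.2 (P.prob_le _ _ _ _))

/-- From node `s` on, the vector `v` is eventually announced as `g` with certainty. -/
def Identifies (g : G) (s : P.Node) (v : (∀ c, Fin (P.dim s c)) → ℂ) : Prop :=
  Filter.Tendsto (fun n => sqNorm v - P.prob g n s v) Filter.atTop (nhds 0)

variable {P}

/-- The overlap does not depend on the number of rounds, while its bound by failure probabilities
tends to zero; no finite round count is needed. -/
theorem Identifies.dotProduct_eq_zero {g h : G} (hgh : g ≠ h) {s : P.Node}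
    {u v : (∀ c, Fin (P.dim s c)) → ℂ} (hu : P.Identifies g s u) (hv : P.Identifies h s v) :
    star u ⬝ᵥ v = 0 := by
  have hlim : Filter.Tendsto (fun n => √(sqNorm u - P.prob g n s u) * √(sqNorm v) +
      √(sqNorm u) * √(sqNorm v - P.prob h n s v)) Filter.atTop (nhds 0) := by
    have := (hu.sqrt.mul_const √(sqNorm v)).add (hv.sqrt.const_mul √(sqNorm u))
    simpa using this
  exact norm_le_zero_iff.1 (ge_of_tendsto' hlim fun n => P.norm_dotProduct_le hgh n s u v)

/-- The failure probability of a node is the sum of the nonnegative failure probabilities of its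
children, so each of them tends to zero. Moving to a child costs one round, hence the index shift.
-/
theorem Identifies.next {g : G} {s : P.Node} (hs : P.verdict s = none)
    {v : (∀ c, Fin (P.dim s c)) → ℂ} (hv : P.Identifies g s v) (k : Fin (P.outcomes s)) :
    P.Identifies g (P.next s k) (applyLocal (P.kraus s k) v) := by
  refine squeeze_zero (fun n => sub_nonneg.2 (P.prob_le _ _ _ _)) (fun n => ?_)
    ((Filter.tendsto_add_atTop_iff_nat 1).2 hv)
  rw [P.prob_succ_of_none hs, ← P.sum_sqNorm_kraus s v, ← Finset.sum_sub_distrib]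
  exact Finset.single_le_sum (f := fun k => sqNorm (applyLocal (P.kraus s k) v) -
    P.prob g n (P.next s k) (applyLocal (P.kraus s k) v))
    (fun k _ => sub_nonneg.2 (P.prob_le _ _ _ _)) (Finset.mem_univ k)

end LOCCProtocol

/-! ### Rigidity of the domino states. -/

/-- The complex number `1 / √2`. -/
def invSqrtTwo : ℂ := ((1 / √2 : ℝ) : ℂ)

theorem invSqrtTwo_ne_zero : invSqrtTwo ≠ 0 := by
  simp [invSqrtTwo]

theorem conj_invSqrtTwo : starRingEnd ℂ invSqrtTwo = invSqrtTwo := Complex.conj_ofReal _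

theorem invSqrtTwo_mul_self : invSqrtTwo * invSqrtTwo = 1 / 2 := by
  rw [invSqrtTwo, ← Complex.ofReal_mul, div_mul_div_comm, Real.mul_self_sqrt (by norm_num)]
  norm_num

/-- The first tensor factor of the eight domino states in `ℂ^3 ⊗ ℂ^3`. -/
def dominoAlice : StateLabel 1 → Fin 3 → ℂ
  | .zeta0 σ => ![invSqrtTwo, invSqrtTwo * (σ : ℤ), 0]
  | .zeta1 _ _ => ![0, 0, 1]
  | .zeta2 _ σ => ![0, invSqrtTwo, invSqrtTwo * (σ : ℤ)]
  | .zeta3 _ _ => ![1, 0, 0]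

/-- The second tensor factor of the eight domino states in `ℂ^3 ⊗ ℂ^3`. -/
def dominoBob : StateLabel 1 → Fin 3 → ℂ
  | .zeta0 _ => ![0, 0, 1]
  | .zeta1 _ σ => ![0, invSqrtTwo, invSqrtTwo * (σ : ℤ)]
  | .zeta2 _ _ => ![1, 0, 0]
  | .zeta3 _ σ => ![invSqrtTwo, invSqrtTwo * (σ : ℤ), 0]

theorem star_dominoAlice_self (d : StateLabel 1) :
    star (dominoAlice d) ⬝ᵥ dominoAlice d = 1 := by
  rcases d with σ | ⟨_, σ⟩ | ⟨_, σ⟩ | ⟨_, σ⟩ <;>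
  rcases Int.units_eq_one_or σ with rfl | rfl <;>
  simp [dominoAlice, dotProduct, Fin.sum_univ_three, conj_invSqrtTwo,
    invSqrtTwo_mul_self] <;> norm_num

theorem star_dominoBob_self (d : StateLabel 1) :
    star (dominoBob d) ⬝ᵥ dominoBob d = 1 := by
  rcases d with σ | ⟨_, σ⟩ | ⟨_, σ⟩ | ⟨_, σ⟩ <;>
  rcases Int.units_eq_one_or σ with rfl | rfl <;>
  simp [dominoBob, dotProduct, Fin.sum_univ_three, conj_invSqrtTwo,
    invSqrtTwo_mul_self] <;> norm_num

/-- Alice's operators that preserve the orthogonality of the domino states are scalar. -/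
theorem exists_eq_smul_one_of_dominoAlice (E : Matrix (Fin 3) (Fin 3) ℂ)
    (h : ∀ d d' : StateLabel 1, d ≠ d' →
      star (dominoAlice d) ⬝ᵥ E *ᵥ dominoAlice d' = 0 ∨
        star (dominoBob d) ⬝ᵥ dominoBob d' = 0) :
    ∃ z : ℂ, E = z • 1 := by
  -- In all these pairs Bob's factors overlap, so the condition falls on `E`. The mixed pairs, taken
  -- with both signs and in both orders, kill the off-diagonal entries without assuming `E`
  -- Hermitian; then `h00` and `h22` equate the diagonal ones.
  have h00 := h (.zeta0 1) (.zeta0 (-1)) (by decide)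
  have h22 := h (.zeta2 0 1) (.zeta2 0 (-1)) (by decide)
  have h01 := h (.zeta0 1) (.zeta1 0 1) (by decide)
  have h01' := h (.zeta0 (-1)) (.zeta1 0 1) (by decide)
  have h10 := h (.zeta1 0 1) (.zeta0 1) (by decide)
  have h10' := h (.zeta1 0 1) (.zeta0 (-1)) (by decide)
  have h23 := h (.zeta2 0 1) (.zeta3 0 1) (by decide)
  have h23' := h (.zeta2 0 (-1)) (.zeta3 0 1) (by decide)
  have h32 := h (.zeta3 0 1) (.zeta2 0 1) (by decide)
  have h32' := h (.zeta3 0 1) (.zeta2 0 (-1)) (by decide)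
  clear h
  have hr := invSqrtTwo_ne_zero
  simp [dominoAlice, dominoBob, dotProduct, Matrix.mulVec, Fin.sum_univ_three,
    conj_invSqrtTwo, hr] at h00 h22 h01 h01' h10 h10' h23 h23' h32 h32'
  refine ⟨E 0 0, ?_⟩
  ext a b
  fin_cases a <;> fin_cases b <;> simp <;> grind

/-- Bob's operators that preserve the orthogonality of the domino states are scalar. -/
theorem exists_eq_smul_one_of_dominoBob (E : Matrix (Fin 3) (Fin 3) ℂ)
    (h : ∀ d d' : StateLabel 1, d ≠ d' →
      star (dominoBob d) ⬝ᵥ E *ᵥ dominoBob d' = 0 ∨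
        star (dominoAlice d) ⬝ᵥ dominoAlice d' = 0) :
    ∃ z : ℂ, E = z • 1 := by
  -- Here Alice's factors overlap in every pair; `h11` and `h33` equate the diagonal entries.
  have h11 := h (.zeta1 0 1) (.zeta1 0 (-1)) (by decide)
  have h33 := h (.zeta3 0 1) (.zeta3 0 (-1)) (by decide)
  have h03 := h (.zeta0 1) (.zeta3 0 1) (by decide)
  have h03' := h (.zeta0 1) (.zeta3 0 (-1)) (by decide)
  have h30 := h (.zeta3 0 1) (.zeta0 1) (by decide)
  have h30' := h (.zeta3 0 (-1)) (.zeta0 1) (by decide)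
  have h12 := h (.zeta1 0 1) (.zeta2 0 1) (by decide)
  have h12' := h (.zeta1 0 (-1)) (.zeta2 0 1) (by decide)
  have h21 := h (.zeta2 0 1) (.zeta1 0 1) (by decide)
  have h21' := h (.zeta2 0 1) (.zeta1 0 (-1)) (by decide)
  clear h
  have hr := invSqrtTwo_ne_zero
  simp [dominoAlice, dominoBob, dotProduct, Matrix.mulVec, Fin.sum_univ_three,
    conj_invSqrtTwo, hr] at h11 h33 h03 h03' h30 h30' h12 h12' h21 h21'
  refine ⟨E 0 0, ?_⟩
  ext a b
  fin_cases a <;> fin_cases b <;> simp <;> grind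

/-! ### Embedded domino states under local operations. -/

/-- The tensor factor of party `c` in the domino state `d` of the parties `cA` and `cB`; the other
parties hold a fixed basis vector. -/
def dominoFactor {κ : Type} [DecidableEq κ] (cA cB : κ) (d : StateLabel 1) (c : κ) : Fin 3 → ℂ :=
  if c = cA then dominoAlice d else if c = cB then dominoBob d else Pi.single 0 1

theorem star_mulVec_dotProduct_mulVec {α β : Type} [Fintype α] [Fintype β] (K : Matrix α β ℂ)
    (u v : β → ℂ) : star (K *ᵥ u) ⬝ᵥ K *ᵥ v = star u ⬝ᵥ (Kᴴ * K) *ᵥ v := by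
  rw [Matrix.star_mulVec, ← Matrix.dotProduct_mulVec, Matrix.mulVec_mulVec]

theorem conjTranspose_mul_self_of_isometry {α β γ : Type} [Fintype α] [Fintype β] [DecidableEq β]
    {U : Matrix α β ℂ} (hU : Uᴴ * U = 1) (K : Matrix β γ ℂ) :
    (U * K)ᴴ * (U * K) = Kᴴ * K := by
  rw [Matrix.conjTranspose_mul, Matrix.mul_assoc, ← Matrix.mul_assoc Uᴴ, hU, Matrix.one_mul]

section

variable {κ : Type} [DecidableEq κ] {Y : κ → Type}

/-- The domino state `d`, embedded into the parties' systems by the operators `K c`. -/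
def dominoVec [Fintype κ] (cA cB : κ) (K : ∀ c, Matrix (Y c) (Fin 3) ℂ) (d : StateLabel 1) :
    (∀ c, Y c) → ℂ :=
  prodVec fun c => K c *ᵥ dominoFactor cA cB d c

theorem applyLocal_dominoVec [Fintype κ] [∀ c, Fintype (Y c)] {Z : κ → Type} (cA cB : κ)
    (K : ∀ c, Matrix (Y c) (Fin 3) ℂ) (A : ∀ c, Matrix (Z c) (Y c) ℂ) (d : StateLabel 1) :
    applyLocal A (dominoVec cA cB K d) = dominoVec cA cB (fun c => A c * K c) d := by
  simp only [dominoVec, applyLocal_prodVec, Matrix.mulVec_mulVec]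

theorem star_dominoFactor_dotProduct_mulVec [∀ c, Fintype (Y c)] {cA cB : κ}
    {K : ∀ c, Matrix (Y c) (Fin 3) ℂ} (hA : ∃ z : ℂ, (K cA)ᴴ * K cA = z • 1)
    (hB : ∃ z : ℂ, (K cB)ᴴ * K cB = z • 1) (c : κ) :
    ∃ z : ℂ, ∀ d d', star (K c *ᵥ dominoFactor cA cB d c) ⬝ᵥ K c *ᵥ dominoFactor cA cB d' c =
      z * (star (dominoFactor cA cB d c) ⬝ᵥ dominoFactor cA cB d' c) := by
  simp only [star_mulVec_dotProduct_mulVec]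
  by_cases h1 : c = cA
  · subst h1
    obtain ⟨z, hz⟩ := hA
    exact ⟨z, fun d d' => by rw [hz, Matrix.smul_mulVec, Matrix.one_mulVec, dotProduct_smul,
      smul_eq_mul]⟩
  by_cases h2 : c = cB
  · subst h2
    obtain ⟨z, hz⟩ := hB
    exact ⟨z, fun d d' => by rw [hz, Matrix.smul_mulVec, Matrix.one_mulVec, dotProduct_smul,
      smul_eq_mul]⟩
  -- A spectator always holds the basis vector `0`, so a single Gram entry plays the role of the
  -- scalar.
  · refine ⟨((K c)ᴴ * K c) 0 0, fun d d' => ?_⟩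
    simp only [dominoFactor, if_neg h1, if_neg h2]
    simp [dotProduct, Pi.single_apply]

theorem star_dominoFactor_self (cA cB c : κ) (d : StateLabel 1) :
    star (dominoFactor cA cB d c) ⬝ᵥ dominoFactor cA cB d c = 1 := by
  unfold dominoFactor
  split_ifs
  · exact star_dominoAlice_self d
  · exact star_dominoBob_self d
  · simp [dotProduct, Pi.single_apply]

theorem sqNorm_dominoVec_eq [Fintype κ] [∀ c, Fintype (Y c)] {cA cB : κ}
    {K : ∀ c, Matrix (Y c) (Fin 3) ℂ} (hA : ∃ z : ℂ, (K cA)ᴴ * K cA = z • 1)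
    (hB : ∃ z : ℂ, (K cB)ᴴ * K cB = z • 1)
    (d d' : StateLabel 1) : sqNorm (dominoVec cA cB K d) = sqNorm (dominoVec cA cB K d') := by
  refine sqNorm_eq_of_dotProduct_eq ?_
  simp only [dominoVec, star_prodVec_dotProduct]
  refine Finset.prod_congr rfl fun c _ => ?_
  obtain ⟨z, hz⟩ := star_dominoFactor_dotProduct_mulVec hA hB c
  rw [hz, hz, star_dominoFactor_self, star_dominoFactor_self]

/-- If an operation that is isometric except at the party `a` keeps the domino states orthogonal,
then its action on the two distinguished parties is a multiple of an isometry. -/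
theorem exists_eq_smul_one_of_orthogonal [Fintype κ] [∀ c, Fintype (Y c)] {Z : κ → Type}
    [∀ c, Fintype (Z c)] [∀ c, DecidableEq (Y c)] {cA cB : κ}
    (hAB : cA ≠ cB) {K : ∀ c, Matrix (Y c) (Fin 3) ℂ}
    (hA : ∃ z : ℂ, (K cA)ᴴ * K cA = z • 1)
    (hB : ∃ z : ℂ, (K cB)ᴴ * K cB = z • 1)
    {A : ∀ c, Matrix (Z c) (Y c) ℂ} {a : κ} (hiso : ∀ c, c ≠ a → (A c)ᴴ * A c = 1)
    (hne : ∃ d, sqNorm (dominoVec cA cB K d) ≠ 0)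
    (horth : ∀ d d', d ≠ d' → star (dominoVec cA cB (fun c => A c * K c) d) ⬝ᵥ
      dominoVec cA cB (fun c => A c * K c) d' = 0) :
    (∃ z : ℂ, (A cA * K cA)ᴴ * (A cA * K cA) = z • 1) ∧
      ∃ z : ℂ, (A cB * K cB)ᴴ * (A cB * K cB) = z • 1 := by
  obtain ⟨d₀, hne⟩ := hne
  have hne' : (∏ c, star (K c *ᵥ dominoFactor cA cB d₀ c) ⬝ᵥ K c *ᵥ dominoFactor cA cB d₀ c)
      ≠ 0 := by
    rw [← star_prodVec_dotProduct, ← dominoVec, ← ofReal_sqNorm]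
    exact_mod_cast hne
  rw [Finset.prod_ne_zero_iff] at hne'
  -- Off the actor the inner products are merely rescaled, by a factor that is nonzero because the
  -- state is. A vanishing factor there was thus orthogonal from the start.
  have hother (c : κ) (hc : c ≠ a) (d d' : StateLabel 1)
      (h : star ((A c * K c) *ᵥ dominoFactor cA cB d c) ⬝ᵥ
        (A c * K c) *ᵥ dominoFactor cA cB d' c = 0) :
      star (dominoFactor cA cB d c) ⬝ᵥ dominoFactor cA cB d' c = 0 := by
    obtain ⟨z, hz⟩ := star_dominoFactor_dotProduct_mulVec hA hB c
    have hz0 : z ≠ 0 := by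
      have := hne' c (Finset.mem_univ c)
      rw [hz] at this
      exact left_ne_zero_of_mul this
    rw [star_mulVec_dotProduct_mulVec, conjTranspose_mul_self_of_isometry (hiso c hc),
      ← star_mulVec_dotProduct_mulVec, hz] at h
    exact (mul_eq_zero.1 h).resolve_left hz0
  have hfactor (d d' : StateLabel 1) (hd : d ≠ d') :
      ∃ c, star ((A c * K c) *ᵥ dominoFactor cA cB d c) ⬝ᵥ
        (A c * K c) *ᵥ dominoFactor cA cB d' c = 0 := by
    have := horth d d' hd
    rw [dominoVec, dominoVec, star_prodVec_dotProduct, Finset.prod_eq_zero_iff] at this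
    obtain ⟨c, -, hc⟩ := this
    exact ⟨c, hc⟩
  have htriv (c : κ) (h1 : c ≠ cA) (h2 : c ≠ cB) (d d' : StateLabel 1) :
      star (dominoFactor cA cB d c) ⬝ᵥ dominoFactor cA cB d' c ≠ 0 := by
    have := star_dominoFactor_self cA cB c d
    simp only [dominoFactor, if_neg h1, if_neg h2] at this ⊢
    rw [this]
    exact one_ne_zero
  have hkeep (c : κ) (hc : c ≠ a) (h : ∃ z : ℂ, (K c)ᴴ * K c = z • 1) :
      ∃ z : ℂ, (A c * K c)ᴴ * (A c * K c) = z • 1 := by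
    rwa [conjTranspose_mul_self_of_isometry (hiso c hc)]
  have hfA (d : StateLabel 1) : dominoFactor cA cB d cA = dominoAlice d := if_pos rfl
  have hfB (d : StateLabel 1) : dominoFactor cA cB d cB = dominoBob d := by
    rw [dominoFactor, if_neg hAB.symm, if_pos rfl]
  refine ⟨?_, ?_⟩
  · by_cases ha : cA = a
    swap
    · exact hkeep cA ha hA
    -- Some party's factor of the vanishing overlap is zero; spectators are excluded, leaving
    -- exactly the alternative of the rigidity lemma.
    refine exists_eq_smul_one_of_dominoAlice _ fun d d' hd => ?_
    obtain ⟨c, hc⟩ := hfactor d d' hd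
    by_cases hcA : c = cA
    · subst hcA
      rw [star_mulVec_dotProduct_mulVec, hfA, hfA] at hc
      exact Or.inl hc
    · have := hother c (ha ▸ hcA) d d' hc
      by_cases hcB : c = cB
      · subst hcB
        rw [hfB, hfB] at this
        exact Or.inr this
      · exact (htriv c hcA hcB d d' this).elim
  · by_cases ha : cB = a
    swap
    · exact hkeep cB ha hB
    refine exists_eq_smul_one_of_dominoBob _ fun d d' hd => ?_
    obtain ⟨c, hc⟩ := hfactor d d' hd
    by_cases hcB : c = cB
    · subst hcB
      rw [star_mulVec_dotProduct_mulVec, hfB, hfB] at hc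
      exact Or.inl hc
    · have := hother c (ha ▸ hcB) d d' hc
      by_cases hcA : c = cA
      · subst hcA
        rw [hfA, hfA] at this
        exact Or.inr this
      · exact (htriv c hcA hcB d d' this).elim

end

/-! ### Protocols cannot tell the domino states apart. -/

namespace LOCCProtocol

variable {κ : Type} [Fintype κ] [DecidableEq κ] {X : κ → Type} [∀ c, Fintype (X c)]
  [∀ c, DecidableEq (X c)] {G : Type} [DecidableEq G] (P : LOCCProtocol κ X G)

/-- A protocol that identifies the domino states learns nothing about them. -/
theorem prob_dominoVec_eq {cA cB : κ} (hAB : cA ≠ cB) {lab : StateLabel 1 → G}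
    (hlab : Function.Injective lab) (g : G) (d d' : StateLabel 1) (n : ℕ) (s : P.Node)
    (K : ∀ c, Matrix (Fin (P.dim s c)) (Fin 3) ℂ)
    (hA : ∃ z : ℂ, (K cA)ᴴ * K cA = z • 1)
    (hB : ∃ z : ℂ, (K cB)ᴴ * K cB = z • 1)
    (hid : ∀ d, P.Identifies (lab d) s (dominoVec cA cB K d)) :
    P.prob g n s (dominoVec cA cB K d) = P.prob g n s (dominoVec cA cB K d') := by
  induction n generalizing s with
  | zero =>
    rcases hs : P.verdict s with _ | g'
    · rw [P.prob_zero_of_none hs, P.prob_zero_of_none hs]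
    · rw [P.prob_of_some hs, P.prob_of_some hs, sqNorm_dominoVec_eq hA hB d d']
  | succ n ih =>
    rcases hs : P.verdict s with _ | g'
    swap
    · rw [P.prob_of_some hs, P.prob_of_some hs, sqNorm_dominoVec_eq hA hB d d']
    -- On a branch of probability zero orthogonality carries no information, but there all the
    -- vectors vanish.
    by_cases hne : sqNorm (dominoVec cA cB K d) = 0
    · rw [eq_zero_of_sqNorm_eq_zero hne,
        eq_zero_of_sqNorm_eq_zero ((sqNorm_dominoVec_eq hA hB d' d).trans hne)]
    rw [P.prob_succ_of_none hs, P.prob_succ_of_none hs]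
    refine Finset.sum_congr rfl fun k _ => ?_
    have hid' (e : StateLabel 1) := (hid e).next hs k
    simp only [applyLocal_dominoVec] at hid' ⊢
    obtain ⟨hA', hB'⟩ := exists_eq_smul_one_of_orthogonal hAB hA hB (P.kraus_isometry s k)
      ⟨d, hne⟩ fun e e' he => (hid' e).dotProduct_eq_zero (hlab.ne he) (hid' e')
    exact ih _ _ hA' hB' hid'

/-- No protocol identifies the domino states of two parties. -/
theorem not_identifies_dominoVec {cA cB : κ} (hAB : cA ≠ cB) {lab : StateLabel 1 → G}
    (hlab : Function.Injective lab) (s : P.Node) (K : ∀ c, Matrix (Fin (P.dim s c)) (Fin 3) ℂ)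
    (hA : ∃ z : ℂ, (K cA)ᴴ * K cA = z • 1)
    (hB : ∃ z : ℂ, (K cB)ᴴ * K cB = z • 1)
    (hne : ∃ d, sqNorm (dominoVec cA cB K d) ≠ 0) :
    ¬ ∀ d, P.Identifies (lab d) s (dominoVec cA cB K d) := by
  intro hid
  obtain ⟨d, hne⟩ := hne
  -- Since norms and verdict probabilities do not depend on the state, the one vector `d` is
  -- identified under every label.
  have hall (e : StateLabel 1) : P.Identifies (lab e) s (dominoVec cA cB K d) := by
    have := hid e
    simp only [Identifies, P.prob_dominoVec_eq hAB hlab (lab e) e d _ s K hA hB hid,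
      sqNorm_dominoVec_eq hA hB e d] at this
    exact this
  have h0 := (hall (.zeta0 1)).dotProduct_eq_zero (hlab.ne (by decide)) (hall (.zeta0 (-1)))
  rw [← ofReal_sqNorm] at h0
  exact hne (by exact_mod_cast h0)

end LOCCProtocol

/-! ### Orthonormality of $\mathbb G_{m+1}$. -/

theorem inner_productState {ι : Type} [Fintype ι] [DecidableEq ι] {X : ι → Type}
    [∀ j, Fintype (X j)] (φ χ : ∀ j, EuclideanSpace ℂ (X j)) :
    inner ℂ (productState φ) (productState χ) = ∏ j, inner ℂ (φ j) (χ j) := by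
  have h (α : Type) [Fintype α] (u v : EuclideanSpace ℂ α) :
      inner ℂ u v = star u.ofLp ⬝ᵥ v.ofLp := by
    rw [EuclideanSpace.inner_eq_star_dotProduct, dotProduct_comm]
  simp only [h]
  exact star_prodVec_dotProduct (fun j => (φ j).ofLp) fun j => (χ j).ofLp

theorem inner_ket_ket {n : ℕ} (a b : Fin n) :
    inner ℂ (ket a) (ket b) = if a = b then 1 else 0 := by
  simp [ket, EuclideanSpace.inner_single_left]

theorem inner_ket_superpose {n : ℕ} (σ : ℤˣ) (a b c : Fin n) :
    inner ℂ (ket c) (superpose σ a b) =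
      invSqrtTwo * ((if c = a then 1 else 0) + ((σ : ℤ) : ℂ) * if c = b then 1 else 0) := by
  simp only [superpose, inner_smul_right, inner_add_right, inner_ket_ket, invSqrtTwo]

theorem inner_superpose_superpose {n : ℕ} (σ τ : ℤˣ) (a b c d : Fin n) :
    inner ℂ (superpose σ a b) (superpose τ c d) =
      1 / 2 * (((if a = c then 1 else 0) + ((τ : ℤ) : ℂ) * if a = d then 1 else 0) +
        ((σ : ℤ) : ℂ) *
          ((if b = c then 1 else 0) + ((τ : ℤ) : ℂ) * if b = d then 1 else 0)) := by
  rw [superpose, inner_smul_left, inner_add_left, inner_smul_left, inner_ket_superpose,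
    inner_ket_superpose, ← invSqrtTwo, conj_invSqrtTwo, ← invSqrtTwo_mul_self, map_intCast]
  ring

theorem inner_superpose_of_ne {n : ℕ} {σ τ : ℤˣ} (h : σ ≠ τ) {a b : Fin n} (hab : a ≠ b) :
    inner ℂ (superpose σ a b) (superpose τ a b) = 0 := by
  rw [inner_superpose_superpose]
  rcases Int.units_eq_one_or σ with rfl | rfl <;> rcases Int.units_eq_one_or τ with rfl | rfl <;>
    simp_all [hab.symm]

theorem norm_eq_one_of_inner_self {α : Type} [Fintype α] {v : EuclideanSpace ℂ α}
    (h : inner ℂ v v = (1 : ℂ)) : ‖v‖ = 1 := by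
  rw [@norm_eq_sqrt_re_inner ℂ, h]
  simp

theorem norm_ket {n : ℕ} (a : Fin n) : ‖ket a‖ = 1 := by simp [ket]

theorem norm_superpose {n : ℕ} (σ : ℤˣ) {a b : Fin n} (hab : a ≠ b) :
    ‖superpose σ a b‖ = 1 := by
  refine norm_eq_one_of_inner_self ?_
  rw [inner_superpose_superpose]
  rcases Int.units_eq_one_or σ with rfl | rfl <;> simp [hab, hab.symm] <;> norm_num

/-- The tensor factors of the states of `𝔾_{m+1}`. -/
def gFactor (m : ℕ) (g : StateLabel m) : ∀ j : Party m, EuclideanSpace ℂ (Fin (partyDim m j))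
  | none => aliceFactor m g
  | some j => bobFactor m j g

theorem gState_eq (m : ℕ) (g : StateLabel m) : gState m g = productState (gFactor m g) := rfl

theorem one_ne_succ_succ {m : ℕ} (i : Fin m) : (1 : Fin (m + 2)) ≠ i.succ.succ := by
  rw [← Fin.succ_zero_eq_one', Ne, Fin.succ_inj]
  exact (Fin.succ_ne_zero i).symm

theorem norm_gFactor (m : ℕ) (g : StateLabel m) (j : Party m) : ‖gFactor m g j‖ = 1 := by
  cases j with
  | none =>
    cases g with
    | zeta0 σ => exact norm_superpose σ (by simp)
    | zeta1 i σ => exact norm_ket _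
    | zeta2 i σ => exact norm_superpose σ (one_ne_succ_succ i)
    | zeta3 i σ => exact norm_ket _
  | some j =>
    change ‖bobFactor m j g‖ = 1
    cases g with
    | zeta0 σ => exact norm_ket _
    | zeta1 i σ | zeta3 i σ =>
      simp only [bobFactor]
      split_ifs
      · exact norm_superpose σ (by decide)
      · exact norm_ket _
    | zeta2 i σ =>
      simp only [bobFactor]
      split_ifs <;> exact norm_ket _

theorem exists_inner_gFactor_eq_zero (m : ℕ) (g h : StateLabel m) (hgh : g ≠ h) :
    ∃ j, inner ℂ (gFactor m g j) (gFactor m h j) = 0 := by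
  suffices H : inner ℂ (aliceFactor m g) (aliceFactor m h) = 0 ∨
      ∃ i, inner ℂ (bobFactor m i g) (bobFactor m i h) = 0 by
    rcases H with H | ⟨i, H⟩
    exacts [⟨none, H⟩, ⟨some i, H⟩]
  have hone (i : Fin m) : (1 : Fin (m + 2)) ≠ i.succ.succ := one_ne_succ_succ i
  have hzero (i : Fin m) : (0 : Fin (m + 2)) ≠ i.succ.succ := (Fin.succ_ne_zero _).symm
  have h01 : (0 : Fin (m + 2)) ≠ 1 := by simp
  have hsymm (σ : ℤˣ) (n : ℕ) (a b c : Fin n) (h : inner ℂ (ket c) (superpose σ a b) = 0) :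
      inner ℂ (superpose σ a b) (ket c) = 0 := inner_eq_zero_symm.1 h
  -- Within a family, equal indices force opposite signs; distinct indices are separated by Alice
  -- for `zeta1` and by Bob-$i$ for `zeta2` and `zeta3`.
  rcases g with σ | ⟨i, σ⟩ | ⟨i, σ⟩ | ⟨i, σ⟩ <;> rcases h with τ | ⟨j, τ⟩ | ⟨j, τ⟩ | ⟨j, τ⟩
  · exact Or.inl (inner_superpose_of_ne (fun h : σ = τ => hgh (h ▸ rfl)) h01)
  · exact Or.inl (hsymm _ _ _ _ _ (by simp [inner_ket_superpose, (hone _).symm]))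
  · exact Or.inr ⟨j, by simp [bobFactor, inner_ket_ket]⟩
  · exact Or.inr ⟨j, by simp [bobFactor, inner_ket_superpose]⟩
  · exact Or.inl (by simp [aliceFactor, inner_ket_superpose, (hone _).symm])
  · by_cases hij : i = j
    · subst hij
      exact Or.inr ⟨i, by
        simp only [bobFactor, if_true]
        exact inner_superpose_of_ne (fun h : σ = τ => hgh (h ▸ rfl)) (by decide)⟩
    · exact Or.inl (by simp [aliceFactor, inner_ket_ket, hij])
  · by_cases hij : i = j
    · subst hij
      exact Or.inr ⟨i, by
        simp only [bobFactor, if_true]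
        exact hsymm _ _ _ _ _ (by simp [inner_ket_superpose])⟩
    · exact Or.inl (by simp [aliceFactor, inner_ket_superpose, hij, (hone _).symm])
  · exact Or.inl (by simp [aliceFactor, inner_ket_ket])
  · exact Or.inr ⟨i, by simp [bobFactor, inner_ket_ket]⟩
  · by_cases hij : i = j
    · subst hij
      exact Or.inr ⟨i, by simp [bobFactor, inner_ket_superpose]⟩
    · exact Or.inl (hsymm _ _ _ _ _
        (by simp [inner_ket_superpose, Ne.symm hij, (hone _).symm]))
  · by_cases hij : i = j
    · subst hij
      exact Or.inl (inner_superpose_of_ne (fun h : σ = τ => hgh (h ▸ rfl)) (hone i))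
    · exact Or.inr ⟨i, by simp [bobFactor, inner_ket_ket, hij]⟩
  · exact Or.inl (hsymm _ _ _ _ _ (by simp [inner_ket_superpose, hzero]))
  · exact Or.inr ⟨i, by
      simp only [bobFactor, if_true]
      exact hsymm _ _ _ _ _ (by simp [inner_ket_superpose])⟩
  · exact Or.inl (by simp [aliceFactor, inner_ket_ket, hzero])
  · exact Or.inl (by simp [aliceFactor, inner_ket_superpose, hzero])
  · by_cases hij : i = j
    · subst hij
      exact Or.inr ⟨i, by
        simp only [bobFactor, if_true]
        exact inner_superpose_of_ne (fun h : σ = τ => hgh (h ▸ rfl)) (by decide)⟩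
    · exact Or.inr ⟨i, by
        simp only [bobFactor, if_true, if_neg hij]
        exact hsymm _ _ _ _ _ (by simp [inner_ket_superpose])⟩

theorem orthonormal_gState (m : ℕ) : Orthonormal ℂ (gState m) := by
  refine ⟨fun g => ?_, fun g h hgh => ?_⟩
  · refine norm_eq_one_of_inner_self ?_
    rw [gState_eq, inner_productState]
    refine Finset.prod_eq_one fun j _ => ?_
    rw [inner_self_eq_norm_sq_to_K, norm_gFactor]
    simp
  · obtain ⟨j, hj⟩ := exists_inner_gFactor_eq_zero m g h hgh
    change inner ℂ (gState m g) (gState m h) = 0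
    rw [gState_eq, gState_eq, inner_productState]
    exact Finset.prod_eq_zero (Finset.mem_univ j) hj

/-! ### Domino states inside a grouping of the parties. -/

/-- The domino states of Alice and the `i`-th Bob among the states of `𝔾_{m+1}`. -/
def dominoLabel {m : ℕ} (i : Fin m) : StateLabel 1 → StateLabel m
  | .zeta0 σ => .zeta0 σ
  | .zeta1 _ σ => .zeta1 i σ
  | .zeta2 _ σ => .zeta2 i σ
  | .zeta3 _ σ => .zeta3 i σ

theorem dominoLabel_injective {m : ℕ} (i : Fin m) : Function.Injective (dominoLabel i) := by
  rintro (σ | ⟨a, σ⟩ | ⟨a, σ⟩ | ⟨a, σ⟩) (τ | ⟨b, τ⟩ | ⟨b, τ⟩ | ⟨b, τ⟩) h <;>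
    simp_all [dominoLabel, eq_iff_true_of_subsingleton]

/-- The basis vectors, `p`, `q` and `i` for Alice and the `i`-th Bob, that span the domino
states. -/
def dominoIndex {m : ℕ} (i : Fin m) (t : Fin 3) : ∀ j : Party m, Fin (partyDim m j)
  | none => (![0, 1, i.succ.succ] : Fin 3 → Fin (m + 2)) t
  | some j => if j = i then t else 2

theorem dominoIndex_none_injective {m : ℕ} (i : Fin m) :
    Function.Injective fun t => dominoIndex i t none := by
  have := one_ne_succ_succ i
  intro t t' h
  fin_cases t <;> fin_cases t' <;> simp_all [dominoIndex, eq_comm]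

theorem dominoIndex_some_injective {m : ℕ} (i : Fin m) :
    Function.Injective fun t => dominoIndex i t (some i) := by
  intro t t' h
  simpa [dominoIndex] using h

theorem gFactor_dominoLabel_none {m : ℕ} (i : Fin m) (d : StateLabel 1)
    (x : Fin (partyDim m none)) :
    gFactor m (dominoLabel i d) none x =
      ∑ t, dominoAlice d t * ket (dominoIndex i t none) x := by
  rcases d with σ | ⟨_, σ⟩ | ⟨_, σ⟩ | ⟨_, σ⟩ <;>
    simp [gFactor, dominoLabel, aliceFactor, dominoAlice, dominoIndex, superpose,
      Fin.sum_univ_three, invSqrtTwo] <;> ring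

theorem gFactor_dominoLabel_some {m : ℕ} (i : Fin m) (d : StateLabel 1)
    (x : Fin (partyDim m (some i))) :
    gFactor m (dominoLabel i d) (some i) x =
      ∑ t, dominoBob d t * ket (dominoIndex i t (some i)) x := by
  rcases d with σ | ⟨_, σ⟩ | ⟨_, σ⟩ | ⟨_, σ⟩ <;>
    simp [gFactor, dominoLabel, bobFactor, dominoBob, dominoIndex, superpose,
      Fin.sum_univ_three, invSqrtTwo] <;> ring

theorem gFactor_dominoLabel_of_ne {m : ℕ} {i : Fin m} (d : StateLabel 1) (t : Fin 3)
    {j : Party m} (h0 : j ≠ none) (hi : j ≠ some i) :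
    gFactor m (dominoLabel i d) j = ket (dominoIndex i t j) := by
  obtain ⟨j, rfl⟩ := Option.ne_none_iff_exists'.1 h0
  have hji : j ≠ i := fun h => hi (h ▸ rfl)
  rcases d with σ | ⟨_, σ⟩ | ⟨_, σ⟩ | ⟨_, σ⟩ <;>
    simp [gFactor, dominoLabel, bobFactor, dominoIndex, hji]

/-- Multilinearity for a group in which only the member `j₀` is in superposition and the rest hold
fixed basis vectors. -/
theorem prod_eq_sum_mul_prod {ι τ : Type} [Fintype ι] [DecidableEq ι] [Fintype τ] (j₀ : ι)
    {F : ι → ℂ} {e : τ → ι → ℂ} {a : τ → ℂ} (h₀ : F j₀ = ∑ t, a t * e t j₀)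
    (h : ∀ j, j ≠ j₀ → ∀ t, F j = e t j) : ∏ j, F j = ∑ t, (∏ j, e t j) * a t := by
  rw [← Finset.mul_prod_erase _ _ (Finset.mem_univ j₀), h₀, Finset.sum_mul]
  refine Finset.sum_congr rfl fun t _ => ?_
  rw [← Finset.mul_prod_erase _ (e t) (Finset.mem_univ j₀),
    Finset.prod_congr rfl fun j hj => h j (Finset.ne_of_mem_erase hj) t]
  ring

/-- The embedding of `ℂ^3` into the joint system of the group `c` along `dominoIndex`. -/
def dominoEmbed {m k : ℕ} (part : Party m → Fin k) (i : Fin m) (c : Fin k) :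
    Matrix (∀ j : {j : Party m // part j = c}, Fin (partyDim m j)) (Fin 3) ℂ :=
  Matrix.of fun y t => ∏ j, ket (dominoIndex i t j.1) (y j)

theorem conjTranspose_dominoEmbed_mul_self {m k : ℕ} (part : Party m → Fin k) (i : Fin m)
    (c : Fin k) (t t' : Fin 3) :
    ((dominoEmbed part i c)ᴴ * dominoEmbed part i c) t t' =
      if ∀ j : {j : Party m // part j = c}, dominoIndex i t j.1 = dominoIndex i t' j.1
      then 1 else 0 := by
  have h := star_prodVec_dotProduct
    (fun j : {j : Party m // part j = c} => (ket (dominoIndex i t j.1)).ofLp)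
    (fun j : {j : Party m // part j = c} => (ket (dominoIndex i t' j.1)).ofLp)
  refine Eq.trans h ?_
  have h2 (n : ℕ) (a b : Fin n) : star (ket a).ofLp ⬝ᵥ (ket b).ofLp = if a = b then 1 else 0 := by
    rw [← inner_ket_ket, EuclideanSpace.inner_eq_star_dotProduct, dotProduct_comm]
  simp only [h2, Finset.prod_ite_zero, Finset.prod_const_one, Finset.mem_univ, true_imp_iff]

/-- One member whose basis vector determines `t` makes the columns orthonormal. Alice and Bob-$i$
are such members; groups with neither have all columns equal. -/
theorem conjTranspose_dominoEmbed_mul_self_eq_one {m k : ℕ} (part : Party m → Fin k) (i : Fin m)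
    (j : Party m) (hj : Function.Injective fun t => dominoIndex i t j) :
    (dominoEmbed part i (part j))ᴴ * dominoEmbed part i (part j) = 1 := by
  ext t t'
  rw [conjTranspose_dominoEmbed_mul_self, Matrix.one_apply]
  refine if_congr ⟨fun h => hj (h ⟨j, rfl⟩), fun h => ?_⟩ rfl rfl
  subst h
  exact fun _ => rfl

theorem regroup_gState_dominoLabel {m k : ℕ} {part : Party m → Fin k} {i : Fin m}
    (hi : part none ≠ part (some i)) (d : StateLabel 1) :
    (regroup part (gState m (dominoLabel i d))).ofLp =
      dominoVec (part none) (part (some i)) (dominoEmbed part i) d := by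
  funext y
  have h1 : (regroup part (gState m (dominoLabel i d))).ofLp y =
      ∏ j, gFactor m (dominoLabel i d) j (y (part j) ⟨j, rfl⟩) := rfl
  have h2 : ∏ j, gFactor m (dominoLabel i d) j (y (part j) ⟨j, rfl⟩) =
      ∏ c, ∏ j : {j : Party m // part j = c}, gFactor m (dominoLabel i d) j.1 (y c j) := by
    rw [← Fintype.prod_fiberwise part]
    refine Finset.prod_congr rfl fun c _ => Finset.prod_congr rfl fun j _ => ?_
    obtain ⟨j, rfl⟩ := j
    rfl
  rw [h1, h2, dominoVec, prodVec]
  refine Finset.prod_congr rfl fun c _ => ?_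
  have h3 (f : Fin 3 → ℂ) : (dominoEmbed part i c *ᵥ f) (y c) =
      ∑ t, (∏ j : {j : Party m // part j = c}, ket (dominoIndex i t j.1) (y c j)) * f t := rfl
  rw [h3]
  by_cases hA : c = part none
  · subst hA
    rw [dominoFactor, if_pos rfl]
    refine prod_eq_sum_mul_prod ⟨none, rfl⟩ (gFactor_dominoLabel_none i d _) fun j hj t => ?_
    rw [gFactor_dominoLabel_of_ne d t (fun h => hj (Subtype.ext h))
      fun h => hi (by rw [← h, j.2])]
  by_cases hB : c = part (some i)
  · subst hB
    rw [dominoFactor, if_neg hA, if_pos rfl]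
    refine prod_eq_sum_mul_prod ⟨some i, rfl⟩ (gFactor_dominoLabel_some i d _) fun j hj t => ?_
    rw [gFactor_dominoLabel_of_ne d t (fun h => hA (by rw [← h, j.2]))
      fun h => hj (Subtype.ext h)]
  -- For a spectator group the embedding does not depend on `t`, so the column `0` chosen in
  -- `dominoFactor` is as good as any.
  · rw [dominoFactor, if_neg hA, if_neg hB, Finset.sum_eq_single 0 (by simp_all) (by simp)]
    rw [Pi.single_eq_same, mul_one]
    refine Finset.prod_congr rfl fun j _ => ?_
    rw [gFactor_dominoLabel_of_ne d 0 (fun h => hA (by rw [← h, j.2]))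
      fun h => hB (by rw [← h, j.2])]

theorem sqNorm_dominoVec_dominoEmbed {m k : ℕ} {part : Party m → Fin k} {i : Fin m}
    {Y : Fin k → Type} [∀ c, Fintype (Y c)]
    {U : ∀ c, Matrix (Y c) (∀ j : {j : Party m // part j = c}, Fin (partyDim m j)) ℂ}
    (hU : ∀ c, (U c)ᴴ * U c = 1) (d : StateLabel 1) :
    sqNorm (dominoVec (part none) (part (some i)) (fun c => U c * dominoEmbed part i c) d) = 1 := by
  have h : ((sqNorm (dominoVec (part none) (part (some i))
      (fun c => U c * dominoEmbed part i c) d) : ℝ) : ℂ) = 1 := by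
    rw [ofReal_sqNorm, dominoVec, star_prodVec_dotProduct]
    refine Finset.prod_eq_one fun c _ => ?_
    rw [star_mulVec_dotProduct_mulVec, conjTranspose_mul_self_of_isometry (hU c)]
    by_cases hA : c = part none
    · subst hA
      rw [conjTranspose_dominoEmbed_mul_self_eq_one _ _ _ (dominoIndex_none_injective i),
        Matrix.one_mulVec, star_dominoFactor_self]
    by_cases hB : c = part (some i)
    · subst hB
      rw [conjTranspose_dominoEmbed_mul_self_eq_one _ _ _ (dominoIndex_some_injective i),
        Matrix.one_mulVec, star_dominoFactor_self]
    · rw [dominoFactor, if_neg hA, if_neg hB]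
      simp [dotProduct, Pi.single_apply, conjTranspose_dominoEmbed_mul_self, Fin.sum_univ_three]
  exact_mod_cast h

theorem not_loccDiscriminable_regroup_gState {m k : ℕ} {part : Party m → Fin k} {i : Fin m}
    (hi : part none ≠ part (some i)) :
    ¬ LOCCDiscriminable fun g => regroup part (gState m g) := by
  rintro ⟨P, hP⟩
  have hgram (j : Party m) (hj : Function.Injective fun t => dominoIndex i t j) :
      ∃ z : ℂ, (P.init (part j) * dominoEmbed part i (part j))ᴴ *
        (P.init (part j) * dominoEmbed part i (part j)) = z • 1 :=
    ⟨1, by rw [conjTranspose_mul_self_of_isometry (P.init_isometry _),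
      conjTranspose_dominoEmbed_mul_self_eq_one _ _ _ hj, one_smul]⟩
  refine P.not_identifies_dominoVec hi (dominoLabel_injective i) P.root
    (fun c => P.init c * dominoEmbed part i c)
    (hgram none (dominoIndex_none_injective i)) (hgram (some i) (dominoIndex_some_injective i))
    ⟨.zeta0 1, ?_⟩ fun d => ?_
  · rw [sqNorm_dominoVec_dominoEmbed P.init_isometry]
    exact one_ne_zero
  · have h := (hP (dominoLabel i d)).const_sub 1
    rw [sub_self] at h
    rw [LOCCProtocol.Identifies, sqNorm_dominoVec_dominoEmbed P.init_isometry,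
      ← applyLocal_dominoVec, ← regroup_gState_dominoLabel hi]
    exact h

/-- Otherwise every Bob would share Alice's group. She is the hub: each Bob forms a domino set with
her. -/
theorem exists_part_none_ne {m k : ℕ} {part : Party m → Fin k} (h : ∃ a b, part a ≠ part b) :
    ∃ i, part none ≠ part (some i) := by
  by_contra! hall
  obtain ⟨a, b, hab⟩ := h
  have (j : Party m) : part j = part none := by
    cases j with
    | none => rfl
    | some i => exact (hall i).symm
  exact hab ((this a).trans (this b).symm)

theorem isGNPS_gState (m : ℕ) : IsGNPS (gState m) := by
  refine ⟨fun g => ⟨gFactor m g, norm_gFactor m g, rfl⟩, orthonormal_gState m,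
    fun k part h => ?_⟩
  obtain ⟨i, hi⟩ := exists_part_none_ne h
  exact not_loccDiscriminable_regroup_gState hi

end

theorem proposition2 (m : ℕ) (hm : 1 ≤ m) :
    IsGNPS (gState m) ∧
    ∀ j : Party m, ¬ LOCCDiscriminable fun g => regroup (allBut j) (gState m g) := by
  refine ⟨isGNPS_gState m, fun j => (isGNPS_gState m).2.2 2 (allBut j) ?_⟩
  -- At least one Bob exists, so there is a party other than `j` and the grouping `allBut j` is
  -- nontrivial.
  have : Nonempty (Fin m) := ⟨⟨0, hm⟩⟩
  obtain ⟨b, hb⟩ := exists_ne j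
  exact ⟨j, b, by simp [allBut, hb]⟩
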